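/- Consider the oriented graph with vertex set $\mathbb{Z}^2$ in which each vertex $(x,y)$ has exactly three outgoing edges, toward $(x-1,y+1)$, $(x,y+1)$ and $(x+1,y+1)$. For $p\in[0,1]$, in site percolation each vertex is open with probability $p$ and closed with probability $1-p$, independently of the others; in bond percolation each oriented edge is open with probability $p$ and closed with probability $1-p$, independently of the others. In each of the two models let $\mathbb{P}_p$ denote the resulting law. An open path is an oriented path all of whose vertices (for site percolation), respectively all of whose edges (for bond percolation), are open. For each model define \[ p_c=\inf\{p\in(0,1] : \mathbb{P}_p(\text{there exists an infinite open path starting from } (0,0))>0\}. \] Then $p_c\ge 0.525$ for site percolation, and $p_c\ge 0.4022$ for bond percolation. -/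

import Mathlib

open MeasureTheory ProbabilityTheory unitInterval

/-- The alternative oriented lattice: the vertex set is `ℤ × ℤ`, and the oriented edges starting
from `(x, y)` are those toward `(x - 1, y + 1)`, `(x, y + 1)` and `(x + 1, y + 1)`. -/
def altLattice : Digraph (ℤ × ℤ) where
  Adj v w := w = (v.1 - 1, v.2 + 1) ∨ w = (v.1, v.2 + 1) ∨ w = (v.1 + 1, v.2 + 1)

/-- An infinite oriented path of the digraph `G` starting from the vertex `o`. -/
def IsInfinitePathFrom {V : Type*} (G : Digraph V) (o : V) (γ : ℕ → V) : Prop :=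
  γ 0 = o ∧ ∀ n, G.Adj (γ n) (γ (n + 1))

/-- The law of the random set of open vertices in site percolation with parameter `p`: each vertex
is open with probability `p`, independently of the others. -/
noncomputable def altSiteLaw (p : I) : Measure (Set (ℤ × ℤ)) :=
  setBernoulli Set.univ p

/-- The law of the random set of open edges in bond percolation with parameter `p`: each edge
of the lattice is open with probability `p`, independently of the others. -/
noncomputable def altBondLaw (p : I) : Measure (Set ((ℤ × ℤ) × (ℤ × ℤ))) :=
  setBernoulli {e | altLattice.Adj e.1 e.2} p

/-- The configurations of open vertices for which there is an infinite open path from the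
origin. -/
def altSitePercolates : Set (Set (ℤ × ℤ)) :=
  {ω | ∃ γ, IsInfinitePathFrom altLattice (0, 0) γ ∧ ∀ n, γ n ∈ ω}

/-- The configurations of open edges for which there is an infinite open path from the origin. -/
def altBondPercolates : Set (Set ((ℤ × ℤ) × (ℤ × ℤ))) :=
  {ω | ∃ γ, IsInfinitePathFrom altLattice (0, 0) γ ∧ ∀ n, (γ n, γ (n + 1)) ∈ ω}

/-- The critical point of site percolation on the alternative lattice: the infimum of the
parameters `p > 0` for which an infinite open path from the origin has positive probability. -/
noncomputable def altSiteCriticalPoint : ℝ :=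
  sInf {r : ℝ | ∃ p : I, (p : ℝ) = r ∧ 0 < r ∧ 0 < altSiteLaw p altSitePercolates}

/-- The critical point of bond percolation on the alternative lattice: the infimum of the
parameters `p > 0` for which an infinite open path from the origin has positive probability. -/
noncomputable def altBondCriticalPoint : ℝ :=
  sInf {r : ℝ | ∃ p : I, (p : ℝ) = r ∧ 0 < r ∧ 0 < altBondLaw p altBondPercolates}

/-! ### Independence of the coordinates under `setBernoulli`. -/

section SetBernoulli

variable {ι : Type*}

/-! At level `n` an infinite path sits at some `x ≥ 0` or some `x ≤ 0`, so by reflection it is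
enough that the probability of reaching `[0, ∞)` at level `n` tends to `0`. This follows from a
Lyapunov function on sets of occupied sites. A set with right edge at most `e` gets the weight `z ^
e * w`, with `z > 1`, where `w` depends on bounds for finitely many neighbour counts read leftwards
from `e`; these words and their weights are stored in a trie.

The next level is revealed site by site from right to left. Each site is reached independently of
everything to its left and of all later levels, with probability at most `Q c / 10 ^ 6` if it has at
most `c` occupied neighbours (`IsExploration.measureReal_scanEvent_le`). Hence the expected new
weight is bounded by a recursion in integer arithmetic: `firstScan` looks for the new right edge,
`edgeScan` and `scan` then read the word to its left (`scanEvent_le_firstScan`,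
`scanEvent_le_scan`). Letters beyond the known word are replaced by the worst case `3`.

If at every leaf the bound is at most `1 - 1 / M` times the weight, the probability decays
geometrically (`allLeaves_weightBound`, `measureReal_hitEvent_le`). This finite condition is
evaluated by the kernel in `check_bondTrie` and `check_siteTrie`. -/

lemma measurableSet_setOf_mem (i : ι) : MeasurableSet {s : Set ι | i ∈ s} :=
  measurable_set_mem i |>.setOf

open scoped Classical in
lemma setBernoulli_biInter_mem (u : Set ι) (p : I) (S : Finset ι) :
    setBernoulli u p (⋂ i ∈ S, {s | i ∈ s}) =
      ∏ i ∈ S, if i ∈ u then (toNNReal p : ENNReal) else 0 := by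
  have h : (fun p : ι → Prop ↦ {i | p i}) ⁻¹' (⋂ i ∈ S, {s | i ∈ s}) =
      Set.pi S (fun _ ↦ {True}) := by
    ext f
    simp [Set.mem_pi]
  rw [setBernoulli_apply', h, Measure.infinitePi_pi _ (fun _ _ ↦ .of_discrete)]
  refine Finset.prod_congr rfl fun i _ ↦ ?_
  by_cases hi : i ∈ u <;> simp [hi]

lemma setBernoulli_real_mem {u : Set ι} {i : ι} (hi : i ∈ u) (p : I) :
    (setBernoulli u p).real {s | i ∈ s} = p := by
  have h := setBernoulli_biInter_mem u p {i}
  simp only [Finset.mem_singleton, Set.iInter_iInter_eq_left, Finset.prod_singleton, hi,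
    if_true] at h
  simp [Measure.real, h]

/-- Indices outside `u` are included, their events being null. Thus step events may be indexed by
all displacements, not only by those that give lattice edges. -/
lemma iIndepSet_setBernoulli (u : Set ι) (p : I) :
    iIndepSet (fun i : ι ↦ {s : Set ι | i ∈ s}) (setBernoulli u p) := by
  classical
  rw [iIndepSet_iff_meas_biInter measurableSet_setOf_mem]
  intro S
  rw [setBernoulli_biInter_mem]
  refine Finset.prod_congr rfl fun i _ ↦ ?_
  have h := setBernoulli_biInter_mem u p {i}
  simpa using h.symm

end SetBernoulli

/-! ### Random subsets of `ℤ` and the level-by-level exploration -/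

section Exploration

variable {Ω : Type*}

/-- The number of elements of `A` among `x - 1`, `x` and `x + 1`. -/
noncomputable def nbrCount (A : Set ℤ) (x : ℤ) : ℕ :=
  A.indicator 1 (x - 1) + A.indicator 1 x + A.indicator 1 (x + 1)

lemma indicator_one_le (A : Set ℤ) (x : ℤ) : A.indicator (1 : ℤ → ℕ) x ≤ 1 := by
  by_cases h : x ∈ A <;> simp [h]

lemma nbrCount_le_three (A : Set ℤ) (x : ℤ) : nbrCount A x ≤ 3 := by
  have h1 := indicator_one_le A (x - 1)
  have h2 := indicator_one_le A x
  have h3 := indicator_one_le A (x + 1)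
  unfold nbrCount
  omega

lemma nbrCount_congr {A B : Set ℤ} {x : ℤ} (h : ∀ z, x - 1 ≤ z → z ≤ x + 1 → (z ∈ A ↔ z ∈ B)) :
    nbrCount A x = nbrCount B x := by
  have h' : ∀ z, x - 1 ≤ z → z ≤ x + 1 →
      A.indicator (1 : ℤ → ℕ) z = B.indicator (1 : ℤ → ℕ) z := by
    intro z h1 h2
    by_cases hz : z ∈ B
    · simp [hz, (h z h1 h2).2 hz]
    · simp [hz, mt (h z h1 h2).1 hz]
  unfold nbrCount
  rw [h' _ (by omega) (by omega), h' x (by omega) (by omega), h' _ (by omega) (by omega)]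

/-- A deterministic set, as a random set. -/
def constSet (Ω : Type*) (A : Set ℤ) : ℤ → Set Ω := fun x ↦ {_ω | x ∈ A}

/-- The sites of level `m + 1` that are reached from the random set `A` of sites of level `m`, when
`R m x d` is the event that the step from `x + d` at level `m` to `x` at level `m + 1` is open. -/
def nextSet (R : ℕ → ℤ → ℤ → Set Ω) (m : ℕ) (A : ℤ → Set Ω) (x : ℤ) : Set Ω :=
  (A (x - 1) ∩ R m x (-1)) ∪ (A x ∩ R m x 0) ∪ (A (x + 1) ∩ R m x 1)

/-- The event that, starting from the random set `A` of sites of level `m`, some site `x ≥ 0` of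
level `m + n` is reached. -/
def hitEvent (R : ℕ → ℤ → ℤ → Set Ω) : ℕ → ℕ → (ℤ → Set Ω) → Set Ω
  | 0, _, A => ⋃ (x : ℤ) (_ : 0 ≤ x), A x
  | n + 1, m, A => hitEvent R n (m + 1) (nextSet R m A)

variable {R : ℕ → ℤ → ℤ → Set Ω}

lemma hitEvent_mono {ω : Ω} : ∀ {n m : ℕ} {A B : ℤ → Set Ω}, (∀ x, ω ∈ A x → ω ∈ B x) →
    ω ∈ hitEvent R n m A → ω ∈ hitEvent R n m B
  | 0, m, A, B, h, hA => by
    simp only [hitEvent, Set.mem_iUnion] at hA ⊢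
    obtain ⟨x, hx, h'⟩ := hA
    exact ⟨x, hx, h x h'⟩
  | n + 1, m, A, B, h, hA => by
    refine hitEvent_mono (n := n) (fun x hx ↦ ?_) hA
    rcases hx with (hx | hx) | hx
    · exact Or.inl (Or.inl ⟨h _ hx.1, hx.2⟩)
    · exact Or.inl (Or.inr ⟨h _ hx.1, hx.2⟩)
    · exact Or.inr ⟨h _ hx.1, hx.2⟩

lemma not_mem_hitEvent {ω : Ω} : ∀ {n m : ℕ} {A : ℤ → Set Ω}, (∀ x, ω ∉ A x) →
    ω ∉ hitEvent R n m A
  | 0, m, A, h => by simp [hitEvent, h]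
  | n + 1, m, A, h => by
    refine not_mem_hitEvent (n := n) (fun x hx ↦ ?_)
    rcases hx with (hx | hx) | hx <;> exact h _ hx.1

lemma measurableSet_nextSet {F : MeasurableSpace Ω} {m : ℕ} {A : ℤ → Set Ω}
    (hA : ∀ x, MeasurableSet[F] (A x)) {x : ℤ} (hR : ∀ d, MeasurableSet[F] (R m x d)) :
    MeasurableSet[F] (nextSet R m A x) :=
  (((hA _).inter (hR _)).union ((hA _).inter (hR _))).union ((hA _).inter (hR _))

lemma measurableSet_hitEvent {F : MeasurableSpace Ω} : ∀ {n m : ℕ} {A : ℤ → Set Ω},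
    (∀ x, MeasurableSet[F] (A x)) → (∀ k, m ≤ k → ∀ x d, MeasurableSet[F] (R k x d)) →
    MeasurableSet[F] (hitEvent R n m A)
  | 0, m, A, hA, _ => MeasurableSet.iUnion fun x ↦ MeasurableSet.iUnion fun _ ↦ hA x
  | n + 1, m, A, hA, hR =>
    measurableSet_hitEvent (n := n) (fun x ↦ measurableSet_nextSet hA (hR m le_rfl x))
      fun k hk ↦ hR k (by omega)

lemma measurableSet_constSet {F : MeasurableSpace Ω} (A : Set ℤ) (x : ℤ) :
    MeasurableSet[F] (constSet Ω A x) := MeasurableSet.const _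

/-- The event that some site `x ≥ 0` is reached after `n` further levels, from the set of level
`m + 1` that agrees with `K` on the right of `y`, and consists up to `y` of `K` and of the sites
reached from the set `A` of level `m`. -/
def scanEvent (R : ℕ → ℤ → ℤ → Set Ω) (n m : ℕ) (A K : Set ℤ) (y : ℤ) : Set Ω :=
  hitEvent R n (m + 1) fun x ↦
    constSet Ω K x ∪ ({_ω | x ≤ y} ∩ nextSet R m (constSet Ω A) x)

/-- Splitting on the state of `y` moves this site from the random part of the level to the
deterministic part `K`. -/
lemma scanEvent_subset (n m : ℕ) (A K : Set ℤ) (y : ℤ) :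
    scanEvent R n m A K y ⊆
      (nextSet R m (constSet Ω A) y ∩ scanEvent R n m A (insert y K) (y - 1)) ∪
      ((nextSet R m (constSet Ω A) y)ᶜ ∩ scanEvent R n m A K (y - 1)) := by
  intro ω hω
  by_cases h : ω ∈ nextSet R m (constSet Ω A) y
  · refine Or.inl ⟨h, hitEvent_mono (fun x hx ↦ ?_) hω⟩
    rcases hx with hx | ⟨hx, hx'⟩
    · exact Or.inl (Set.mem_insert_of_mem _ hx)
    · rcases eq_or_lt_of_le (show x ≤ y from hx) with rfl | hlt
      · exact Or.inl (Set.mem_insert _ _)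
      · exact Or.inr ⟨show x ≤ y - 1 by omega, hx'⟩
  · refine Or.inr ⟨h, hitEvent_mono (fun x hx ↦ ?_) hω⟩
    rcases hx with hx | ⟨hx, hx'⟩
    · exact Or.inl hx
    · rcases eq_or_lt_of_le (show x ≤ y from hx) with rfl | hlt
      · exact absurd hx' h
      · exact Or.inr ⟨show x ≤ y - 1 by omega, hx'⟩

/-- When all sites of `A` lie at or above `lo`, no site below `lo - 1` is reached from `A`. -/
lemma not_mem_nextSet_of_lt {m : ℕ} {A : Set ℤ} {lo x : ℤ} (hA : ∀ z ∈ A, lo ≤ z)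
    (hx : x + 1 < lo) (ω : Ω) : ω ∉ nextSet R m (constSet Ω A) x := by
  rintro ((h | h) | h)
  · have := hA _ (show x - 1 ∈ A from h.1); omega
  · have := hA _ (show x ∈ A from h.1); omega
  · have := hA _ (show x + 1 ∈ A from h.1); omega

lemma not_mem_nextSet_of_gt {m : ℕ} {A : Set ℤ} {e x : ℤ} (hA : ∀ z ∈ A, z ≤ e)
    (hx : e + 1 < x) (ω : Ω) : ω ∉ nextSet R m (constSet Ω A) x := by
  rintro ((h | h) | h)
  · have := hA _ (show x - 1 ∈ A from h.1); omega
  · have := hA _ (show x ∈ A from h.1); omega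
  · have := hA _ (show x + 1 ∈ A from h.1); omega

lemma scanEvent_subset_of_lt {n m : ℕ} {A K : Set ℤ} {y lo : ℤ} (hA : ∀ z ∈ A, lo ≤ z)
    (hy : y + 1 < lo) : scanEvent R n m A K y ⊆ hitEvent R n (m + 1) (constSet Ω K) := by
  intro ω hω
  refine hitEvent_mono (fun x hx ↦ ?_) hω
  rcases hx with hx | ⟨hx, hx'⟩
  · exact hx
  · exact absurd hx' (not_mem_nextSet_of_lt hA (by have : x ≤ y := hx; omega) ω)

/-- The edge advances by at most one site per level, so the scan may start at `e + 1`. -/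
lemma hitEvent_succ_subset {n m : ℕ} {A : Set ℤ} {e : ℤ} (hA : ∀ x ∈ A, x ≤ e) :
    hitEvent R (n + 1) m (constSet Ω A) ⊆ scanEvent R n m A ∅ (e + 1) := by
  intro ω hω
  refine hitEvent_mono (n := n) (fun x hx ↦ Or.inr ⟨?_, hx⟩) hω
  by_contra hlt
  exact not_mem_nextSet_of_gt hA (not_le.1 hlt) ω hx

/-- The events `R m x d` are independent between different `(m, x)`, and from a set `A` the site `x`
is reached with probability at most `Q c / 10 ^ 6` when at most `c` of its neighbours are in `A`. -/
structure IsExploration [MeasurableSpace Ω] (μ : Measure Ω) (R : ℕ → ℤ → ℤ → Set Ω)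
    (Q : ℕ → ℕ) : Prop where
  exists_key : ∃ (ι : Type) (O : ι → Set Ω) (key : ℕ → ℤ → ℤ → ι), (∀ i, MeasurableSet (O i)) ∧
    iIndepSet O μ ∧ (∀ m x d m' x' d', key m x d = key m' x' d' → m = m' ∧ x = x') ∧
    ∀ m x d, R m x d = O (key m x d)
  prob_le : ∀ m (A : Set ℤ) x c, nbrCount A x ≤ c →
    μ.real (nextSet R m (constSet Ω A) x) ≤ (Q c : ℝ) / 10 ^ 6
  cap_le : ∀ c, Q c ≤ 10 ^ 6

variable [MeasurableSpace Ω] {μ : Measure Ω} {Q : ℕ → ℕ}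

lemma IsExploration.measurableSet (h : IsExploration μ R Q) (m : ℕ) (x d : ℤ) :
    MeasurableSet (R m x d) := by
  obtain ⟨ι, O, key, hO, -, -, hR⟩ := h.exists_key
  rw [hR]
  exact hO _

lemma IsExploration.isProbabilityMeasure (h : IsExploration μ R Q) : IsProbabilityMeasure μ := by
  obtain ⟨ι, O, key, -, hi, -, -⟩ := h.exists_key
  exact hi.isProbabilityMeasure

/-- The exploration below `y` and at later levels is independent of the state of the site `y`. -/
lemma IsExploration.indepSet (h : IsExploration μ R Q) (n m : ℕ) (A K : Set ℤ) (y : ℤ) :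
    IndepSet (nextSet R m (constSet Ω A) y) (scanEvent R n m A K (y - 1)) μ := by
  obtain ⟨ι, O, key, hO, hi, hk, hR⟩ := h.exists_key
  -- `S` holds the coordinates that decide the site `y`, `T` those of the sites to its left and of
  -- all later levels.
  set S : Set ι := {i | ∃ d, i = key m y d}
  set T : Set ι := {i | ∃ k x d, i = key k x d ∧ (m < k ∨ (k = m ∧ x < y))}
  have hST : Disjoint S T := by
    rw [Set.disjoint_left]
    rintro i ⟨d, rfl⟩ ⟨k, x, d', hk', h'⟩
    obtain ⟨rfl, rfl⟩ := hk _ _ _ _ _ _ hk'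
    omega
  have hind := indep_iSup_of_disjoint (m := fun i ↦ MeasurableSpace.generateFrom {O i})
    (fun i ↦ MeasurableSpace.generateFrom_le (by rintro _ rfl; exact hO i)) hi hST
  have hmem : ∀ (U : Set ι) (i : ι), i ∈ U →
      MeasurableSet[⨆ i ∈ U, MeasurableSpace.generateFrom {O i}] (O i) := fun U i hiU ↦
    le_iSup₂ (f := fun i (_ : i ∈ U) ↦ MeasurableSpace.generateFrom {O i}) i hiU _
      (MeasurableSpace.measurableSet_generateFrom rfl)
  refine hind.indepSet_of_measurableSet ?_ ?_
  · refine measurableSet_nextSet (measurableSet_constSet A) fun d ↦ ?_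
    rw [hR]
    exact hmem S _ ⟨d, rfl⟩
  · refine measurableSet_hitEvent (fun x ↦ ?_) fun k hk x d ↦ ?_
    · by_cases hx : x ≤ y - 1
      · refine (measurableSet_constSet K x).union ((MeasurableSet.const _).inter ?_)
        refine measurableSet_nextSet (measurableSet_constSet A) fun d ↦ ?_
        rw [hR]
        exact hmem T _ ⟨m, x, d, rfl, Or.inr ⟨rfl, by omega⟩⟩
      · simp only [hx, Set.ofPred_false, Set.empty_inter, Set.union_empty]
        exact measurableSet_constSet K x
    · rw [hR]
      exact hmem T _ ⟨k, x, d, rfl, Or.inl (by omega)⟩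

/-- Conditioning on the state of `y`: by `IsExploration.indepSet` both pieces of `scanEvent_subset`
factor. -/
lemma IsExploration.measureReal_scanEvent_le (h : IsExploration μ R Q) (n m : ℕ) (A K : Set ℤ)
    (y : ℤ) :
    μ.real (scanEvent R n m A K y) ≤
      μ.real (nextSet R m (constSet Ω A) y) * μ.real (scanEvent R n m A (insert y K) (y - 1)) +
      (1 - μ.real (nextSet R m (constSet Ω A) y)) * μ.real (scanEvent R n m A K (y - 1)) := by
  have := h.isProbabilityMeasure
  have hN : MeasurableSet (nextSet R m (constSet Ω A) y) :=
    measurableSet_nextSet (measurableSet_constSet A) fun d ↦ h.measurableSet m y d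
  have hS : ∀ K, MeasurableSet (scanEvent R n m A K (y - 1)) := fun K ↦
    measurableSet_hitEvent (fun x ↦ (measurableSet_constSet K x).union
      ((MeasurableSet.const _).inter
        (measurableSet_nextSet (measurableSet_constSet A) fun d ↦ h.measurableSet m x d)))
      fun k _ x d ↦ h.measurableSet k x d
  refine (measureReal_mono (scanEvent_subset n m A K y)).trans
    ((measureReal_union_le _ _).trans (add_le_add (le_of_eq ?_) (le_of_eq ?_)))
  · have := (indepSet_iff_measure_inter_eq_mul hN (hS _) μ).1 (h.indepSet n m A (insert y K) y)
    simp [Measure.real, this]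
  · have h1 := congrArg ENNReal.toReal
      ((indepSet_iff_measure_inter_eq_mul hN (hS _) μ).1 (h.indepSet n m A K y))
    rw [ENNReal.toReal_mul] at h1
    have h2 := measureReal_inter_add_sdiff (μ := μ) (s := scanEvent R n m A K (y - 1)) hN
    rw [Set.inter_comm, Set.sdiff_eq, Set.inter_comm _ (_ᶜ)] at h2
    simp only [Measure.real] at h1 h2 ⊢
    linarith

end Exploration

/-! ### Weights of words -/

/-- A trie of words of neighbour counts. A word is read from right to left, starting at the
rightmost occupied site. At `skip t` the next letter is bounded by `3`; at `node m lo hi` it is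
bounded by `m` if possible, leading to `lo`, and otherwise treated by `hi`. A leaf forgets
the rest of the word and carries a weight. -/
inductive WordTrie
  | leaf (w : ℕ)
  | skip (t : WordTrie)
  | node (m : ℕ) (lo hi : WordTrie)

namespace WordTrie

/-- An upper bound for the average of `a` and `b` with weights `t` and `1 - t`, over all
`t ≤ q / 10 ^ 6`. -/
def avg (q a b : ℕ) : ℕ :=
  bif Nat.beq q 0 then b else max b ((q * a + (1000000 - q) * b + 999999) / 1000000)

/-- The expected weight of the word of the next level, when the letter `c` is passed to the trie,
the two sites to its left have states `a` and `b` (from right to left), and the word `us` bounds the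
neighbour counts of the sites that follow. -/
def scan (Q : ℕ → ℕ) : WordTrie → ℕ → List ℕ → ℕ → ℕ → ℕ
  | leaf w, _, _, _, _ => w
  | skip t, _, [], a, b => avg (Q 3) (scan Q t (a + b + 1) [] b 1) (scan Q t (a + b) [] b 0)
  | skip t, _, u :: us, a, b => avg (Q u) (scan Q t (a + b + 1) us b 1) (scan Q t (a + b) us b 0)
  | node m lo hi, c, us, a, b =>
    bif Nat.ble c m then
      match us with
      | [] => avg (Q 3) (scan Q lo (a + b + 1) [] b 1) (scan Q lo (a + b) [] b 0)
      | u :: us => avg (Q u) (scan Q lo (a + b + 1) us b 1) (scan Q lo (a + b) us b 0)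
    else scan Q hi c us a b

/-- The expected weight of the word that starts at an occupied site, when `us` bounds the neighbour
counts of the sites to its left. -/
def edgeScan (Q : ℕ → ℕ) (t : WordTrie) : List ℕ → ℕ
  | [] => avg (Q 3) (scan Q t 2 [] 1 1) (scan Q t 1 [] 1 0)
  | u :: us => avg (Q u) (scan Q t 2 us 1 1) (scan Q t 1 us 1 0)

/-- The weight `v`, divided by `zn / zd` and rounded up. -/
def shift (zn zd v : ℕ) : ℕ := (zd * v + (zn - 1)) / zn

/-- The expected weight of the next level, when `us` bounds the neighbour counts and `T` is the
weight in the absence of a bound. -/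
def firstScan (Q : ℕ → ℕ) (t : WordTrie) (T zn zd : ℕ) : List ℕ → ℕ
  | [] => T
  | c :: us => avg (Q c) (edgeScan Q t us) (shift zn zd (firstScan Q t T zn zd us))

/-- The property `P` holds at all leaves, for the reversed word and the weight of the leaf. -/
def AllLeaves (P : List ℕ → ℕ → Prop) : WordTrie → List ℕ → Prop
  | leaf w, r => P r w
  | skip t, r => AllLeaves P t (3 :: r)
  | node m lo hi, r => AllLeaves P lo (m :: r) ∧ AllLeaves P hi r

/-- Checks a property of the reversed word and the weight at all leaves. -/
def checkLeaves (f : List ℕ → ℕ → Bool) : WordTrie → List ℕ → Bool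
  | leaf w, r => f r w
  | skip t, r => checkLeaves f t (3 :: r)
  | node m lo hi, r => and (checkLeaves f lo (m :: r)) (checkLeaves f hi r)

/-- Checks that the weights are multiplied by at most `1 - 1 / M` in expectation at each level. -/
def check (Q : ℕ → ℕ) (root : WordTrie) (T zn zd M : ℕ) : Bool :=
  and (Nat.ble (avg (Q 3) (edgeScan Q root []) (shift zn zd T)) T)
    (checkLeaves (fun r w ↦ and (Nat.ble 1 w)
      (Nat.ble (M * (zn * firstScan Q root T zn zd (1 :: r.reverse))) ((M - 1) * (zd * w)))) root [])

lemma scan_skip (Q : ℕ → ℕ) (t : WordTrie) (c : ℕ) (us : List ℕ) (a b : ℕ) :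
    scan Q (skip t) c us a b =
      avg (Q (us.headD 3)) (scan Q t (a + b + 1) us.tail b 1) (scan Q t (a + b) us.tail b 0) := by
  cases us <;> rfl

lemma scan_node_of_le (Q : ℕ → ℕ) {c m : ℕ} (h : c ≤ m) (lo hi : WordTrie) (us : List ℕ)
    (a b : ℕ) :
    scan Q (node m lo hi) c us a b =
      avg (Q (us.headD 3)) (scan Q lo (a + b + 1) us.tail b 1) (scan Q lo (a + b) us.tail b 0) := by
  have : Nat.ble c m = true := Nat.ble_eq_true_of_le h
  cases us <;> simp only [scan, this, cond_true, List.headD, List.tail]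

lemma scan_node_of_lt (Q : ℕ → ℕ) {c m : ℕ} (h : m < c) (lo hi : WordTrie) (us : List ℕ)
    (a b : ℕ) : scan Q (node m lo hi) c us a b = scan Q hi c us a b := by
  have : Nat.ble c m = false := by
    rw [Bool.eq_false_iff]
    exact fun h' ↦ absurd (Nat.le_of_ble_eq_true h') (not_le.2 h)
  simp only [scan, this, cond_false]

lemma edgeScan_eq (Q : ℕ → ℕ) (t : WordTrie) (us : List ℕ) :
    edgeScan Q t us = avg (Q (us.headD 3)) (scan Q t 2 us.tail 1 1) (scan Q t 1 us.tail 1 0) := by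
  cases us <;> rfl

lemma AllLeaves.imp {P P' : List ℕ → ℕ → Prop} (h : ∀ r w, P r w → P' r w) :
    ∀ {t : WordTrie} {r : List ℕ}, AllLeaves P t r → AllLeaves P' t r
  | leaf _, _, ht => h _ _ ht
  | skip t, _, ht => AllLeaves.imp (t := t) h ht
  | node _ lo hi, _, ht => ⟨AllLeaves.imp (t := lo) h ht.1, AllLeaves.imp (t := hi) h ht.2⟩

lemma allLeaves_of_checkLeaves {f : List ℕ → ℕ → Bool} : ∀ {t : WordTrie} {r : List ℕ},
    checkLeaves f t r = true → AllLeaves (fun r w ↦ f r w = true) t r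
  | leaf _, _, ht => ht
  | skip t, _, ht => allLeaves_of_checkLeaves (t := t) ht
  | node _ lo hi, _, ht => by
    have := (Bool.and_eq_true _ _).mp ht
    exact ⟨allLeaves_of_checkLeaves (t := lo) this.1, allLeaves_of_checkLeaves (t := hi) this.2⟩

lemma le_natDiv_real (a k : ℕ) (hk : 0 < k) : (a : ℝ) / k ≤ ((a + (k - 1)) / k : ℕ) := by
  rw [div_le_iff₀ (by positivity)]
  have h1 := Nat.div_add_mod (a + (k - 1)) k
  have h2 := Nat.mod_lt (a + (k - 1)) hk
  have h3 : a ≤ (a + (k - 1)) / k * k := by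
    rw [mul_comm]; omega
  exact_mod_cast h3

/-- The average is affine in `t`, hence largest at an endpoint: `t = 0` if `a ≤ b`, and `t = q / 10
^ 6` otherwise. No monotonicity of the weights is needed. -/
lemma le_avg {q a b : ℕ} {t : ℝ} (ht : 0 ≤ t) (htq : t ≤ q / 10 ^ 6) (hq : q ≤ 10 ^ 6) :
    t * a + (1 - t) * b ≤ avg q a b := by
  unfold avg
  rcases Nat.eq_zero_or_pos q with rfl | hpos
  · have : t = 0 := le_antisymm (by simpa using htq) ht
    simp [this]
  · have hne : Nat.beq q 0 = false := by
      cases q with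
      | zero => simp at hpos
      | succ k => rfl
    rw [hne, cond_false]
    have h1 := le_natDiv_real (q * a + (1000000 - q) * b) 1000000 (by norm_num)
    push_cast [Nat.cast_sub (show q ≤ 1000000 by simpa using hq)] at h1 ⊢
    rcases le_total (a : ℝ) b with hab | hab
    · exact le_max_of_le_left (by nlinarith)
    · refine le_max_of_le_right (le_trans ?_ h1)
      rw [le_div_iff₀ (by norm_num)]
      rw [le_div_iff₀ (by norm_num)] at htq
      nlinarith

lemma div_le_shift {zn zd : ℕ} (hz : 0 < zn) (v : ℕ) : (zd : ℝ) * v / zn ≤ shift zn zd v := by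
  have := le_natDiv_real (zd * v) zn hz
  push_cast at this
  exact this

end WordTrie

/-! ### Bounding the scan by the trie recursion. -/

section Bounds

open WordTrie

variable {Ω : Type*} [MeasurableSpace Ω] {μ : Measure Ω} {R : ℕ → ℤ → ℤ → Set Ω} {Q : ℕ → ℕ}

lemma scanEvent_step_le (h : IsExploration μ R Q) {n m c v₁ v₀ : ℕ} {A K : Set ℤ} {y : ℤ} {C : ℝ}
    (hc : nbrCount A y ≤ c) (hC : 0 ≤ C)
    (h₁ : μ.real (scanEvent R n m A (insert y K) (y - 1)) ≤ C * v₁)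
    (h₀ : μ.real (scanEvent R n m A K (y - 1)) ≤ C * v₀) :
    μ.real (scanEvent R n m A K y) ≤ C * avg (Q c) v₁ v₀ := by
  have := h.isProbabilityMeasure
  have ht := h.prob_le m A y c hc
  have ht0 : 0 ≤ μ.real (nextSet R m (constSet Ω A) y) := measureReal_nonneg
  have ht1 : μ.real (nextSet R m (constSet Ω A) y) ≤ 1 := measureReal_le_one
  have hav := le_avg (a := v₁) (b := v₀) ht0 ht (h.cap_le c)
  refine (h.measureReal_scanEvent_le n m A K y).trans ?_
  calc _ ≤ μ.real (nextSet R m (constSet Ω A) y) * (C * v₁) +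
        (1 - μ.real (nextSet R m (constSet Ω A) y)) * (C * v₀) :=
      add_le_add (mul_le_mul_of_nonneg_left h₁ ht0)
        (mul_le_mul_of_nonneg_left h₀ (by linarith))
    _ = C * (μ.real (nextSet R m (constSet Ω A) y) * v₁ +
        (1 - μ.real (nextSet R m (constSet Ω A) y)) * v₀) := by ring
    _ ≤ _ := mul_le_mul_of_nonneg_left hav hC

/-- A bound that holds whatever is reached up to `y` is a bound for the scan. -/
lemma scanEvent_le_of_forall (h : IsExploration μ R Q) {n m : ℕ} {A : Set ℤ} {lo : ℤ} {V : ℝ}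
    (hA : ∀ z ∈ A, lo ≤ z) : ∀ (k : ℕ) (K : Set ℤ) (y : ℤ), y + 1 < lo + k →
    (∀ B : Set ℤ, (∀ x ∈ B, x ≤ y ∧ lo ≤ x + 1) →
      μ.real (hitEvent R n (m + 1) (constSet Ω (K ∪ B))) ≤ V) →
    μ.real (scanEvent R n m A K y) ≤ V := by
  have := h.isProbabilityMeasure
  intro k
  induction k with
  | zero =>
    intro K y hy hV
    have h0 := hV ∅ (by simp)
    rw [Set.union_empty] at h0
    exact (measureReal_mono (scanEvent_subset_of_lt hA (by simpa using hy))).trans h0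
  | succ k ih =>
    intro K y hy hV
    by_cases hlt : y + 1 < lo
    · have h0 := hV ∅ (by simp)
      rw [Set.union_empty] at h0
      exact (measureReal_mono (scanEvent_subset_of_lt hA hlt)).trans h0
    have h₁ : μ.real (scanEvent R n m A (insert y K) (y - 1)) ≤ V := by
      refine ih _ _ (by push_cast at hy; omega) fun B hB ↦ ?_
      have : insert y K ∪ B = K ∪ insert y B := by
        rw [Set.insert_union, Set.union_insert]
      rw [this]
      refine hV _ fun x hx ↦ ?_
      rcases hx with rfl | hx
      · omega
      · have := hB x hx; omega
    have h₀ : μ.real (scanEvent R n m A K (y - 1)) ≤ V := by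
      refine ih _ _ (by push_cast at hy; omega) fun B hB ↦ hV B fun x hx ↦ ?_
      have := hB x hx; omega
    have ht0 : 0 ≤ μ.real (nextSet R m (constSet Ω A) y) := measureReal_nonneg
    have ht1 : μ.real (nextSet R m (constSet Ω A) y) ≤ 1 := measureReal_le_one
    -- A convex combination of two numbers at most `V` is at most `V`.
    refine (h.measureReal_scanEvent_le n m A K y).trans ?_
    nlinarith

/-- The set `A` lies at or to the left of `e`, and its neighbour counts at `e, e - 1, …` are bounded
by the reversed word `r`. -/
def DominatedBy (A : Set ℤ) (r : List ℕ) (e : ℤ) : Prop :=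
  (∀ x ∈ A, x ≤ e) ∧ ∀ j : ℕ, nbrCount A (e - j) ≤ r.reverse.getD j 3

/-- The weight `w` bounds the probability to reach `[0, ∞)` in `n` levels from sets dominated by the
reversed word `r`. -/
def WeightBound (μ : Measure Ω) (R : ℕ → ℤ → ℤ → Set Ω) (z C : ℝ) (n : ℕ) (r : List ℕ) (w : ℕ) :
    Prop :=
  ∀ (m : ℕ) (e lo : ℤ) (A : Set ℤ), (∀ x ∈ A, lo ≤ x) → DominatedBy A r e →
    μ.real (hitEvent R n m (constSet Ω A)) ≤ C * z ^ e * w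

lemma nbrCount_insert_of_lt {K : Set ℤ} {y x : ℤ} (h : y + 1 < x) :
    nbrCount (insert y K) x = nbrCount K x :=
  nbrCount_congr fun z h1 _ ↦ by
    rw [Set.mem_insert_iff, or_iff_right (by omega)]

lemma indicator_insert_of_ne {K : Set ℤ} {x y : ℤ} (h : x ≠ y) :
    (insert y K).indicator (1 : ℤ → ℕ) x = K.indicator 1 x := by
  by_cases hx : x ∈ K <;> simp [hx, h]

lemma nbrCount_insert {K : Set ℤ} {y : ℤ} :
    nbrCount (insert y K) (y + 1) =
      K.indicator 1 (y + 2) + K.indicator 1 (y + 1) + 1 := by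
  have h1 : (insert y K).indicator (1 : ℤ → ℕ) (y + 1 - 1) = 1 := by simp
  have h2 : (insert y K).indicator (1 : ℤ → ℕ) (y + 1) = K.indicator 1 (y + 1) :=
    indicator_insert_of_ne (by omega)
  have h3 : (insert y K).indicator (1 : ℤ → ℕ) (y + 1 + 1) = K.indicator 1 (y + 2) := by
    rw [show y + 1 + 1 = y + 2 by ring]
    exact indicator_insert_of_ne (by omega)
  unfold nbrCount
  rw [h1, h2, h3]
  ring

lemma nbrCount_of_notMem {K : Set ℤ} {y : ℤ} (hy : y ∉ K) :
    nbrCount K (y + 1) = K.indicator 1 (y + 2) + K.indicator 1 (y + 1) := by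
  have h1 : K.indicator (1 : ℤ → ℕ) (y + 1 - 1) = 0 := by simp [hy]
  unfold nbrCount
  rw [h1, show y + 1 + 1 = y + 2 by ring]
  ring

/-- The reversed word `r` bounds the neighbour counts of `K` at `e, e - 1, …, y + 3`, and `K` is
contained in `(y, e]`. -/
structure ScanInv (K : Set ℤ) (r : List ℕ) (e y : ℤ) : Prop where
  mem : ∀ x ∈ K, y < x ∧ x ≤ e
  length : (r.length : ℤ) = e - y - 2
  le : ∀ j : ℕ, j < r.length → nbrCount K (e - j) ≤ r.reverse.getD j 3

/-- The count at `y + 2` involves only `y + 1`, `y + 2` and `y + 3`, all decided already. It is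
therefore final whatever happens at `y`, and its bound can be appended to the word. -/
lemma ScanInv.succ {K K' : Set ℤ} {r : List ℕ} {e y : ℤ} {c : ℕ} (h : ScanInv K r e y)
    (hK' : K' = K ∨ K' = insert y K) (hc : nbrCount K (y + 2) ≤ c) :
    ScanInv K' (c :: r) e (y - 1) := by
  have hlen := h.length
  have hcount : ∀ x, y + 1 < x → nbrCount K' x = nbrCount K x := by
    rcases hK' with rfl | rfl
    · exact fun _ _ ↦ rfl
    · exact fun x hx ↦ nbrCount_insert_of_lt hx
  refine ⟨fun x hx ↦ ?_, by simp; omega, fun j hj ↦ ?_⟩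
  · rcases hK' with rfl | rfl
    · have := h.mem x hx; omega
    · rcases hx with rfl | hx
      · omega
      · have := h.mem x hx; omega
  · rw [List.length_cons] at hj
    rw [hcount _ (by omega), List.reverse_cons]
    rcases Nat.lt_succ_iff_lt_or_eq.1 hj with hj | rfl
    · rw [List.getD_append _ _ _ _ (by simpa using hj)]
      exact h.le j hj
    · rw [List.getD_append_right _ _ _ _ (by simp), show e - (r.length : ℤ) = y + 2 by omega]
      simpa using hc

/-- Induction on the trie. Only the last two decided sites need to be remembered: the next letter,
the count at `y + 1`, is the sum of their indicators and that of `y`. -/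
lemma scanEvent_le_scan (h : IsExploration μ R Q) {z C : ℝ} (hz : 0 < z) (hC : 0 ≤ C) {n m : ℕ}
    {A : Set ℤ} {lo e : ℤ} (hA : ∀ x ∈ A, lo ≤ x) :
    ∀ (t : WordTrie) (r : List ℕ) (K : Set ℤ) (y : ℤ) (c : ℕ) (us : List ℕ),
      AllLeaves (WeightBound μ R z C n) t r → ScanInv K r e y → nbrCount K (y + 2) ≤ c →
      (∀ j : ℕ, nbrCount A (y - j) ≤ us.getD j 3) →
      μ.real (scanEvent R n m A K y) ≤
        C * z ^ e * scan Q t c us (K.indicator 1 (y + 2)) (K.indicator 1 (y + 1)) := by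
  -- Common to `skip` and to the `lo` branch of `node`: the letter is consumed with bound `c'`, then
  -- `y` is decided.
  have hstep : ∀ (t : WordTrie) (r : List ℕ) (K : Set ℤ) (y : ℤ) (c c' : ℕ) (us : List ℕ),
      (∀ (K : Set ℤ) (y : ℤ) (c : ℕ) (us : List ℕ),
        ScanInv K (c' :: r) e y → nbrCount K (y + 2) ≤ c →
        (∀ j : ℕ, nbrCount A (y - j) ≤ us.getD j 3) →
        μ.real (scanEvent R n m A K y) ≤
          C * z ^ e * scan Q t c us (K.indicator 1 (y + 2)) (K.indicator 1 (y + 1))) →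
      ScanInv K r e y → nbrCount K (y + 2) ≤ c' →
      (∀ j : ℕ, nbrCount A (y - j) ≤ us.getD j 3) →
      μ.real (scanEvent R n m A K y) ≤
        C * z ^ e * avg (Q (us.headD 3))
          (scan Q t (K.indicator 1 (y + 2) + K.indicator 1 (y + 1) + 1) us.tail
            (K.indicator 1 (y + 1)) 1)
          (scan Q t (K.indicator 1 (y + 2) + K.indicator 1 (y + 1)) us.tail
            (K.indicator 1 (y + 1)) 0) := by
    intro t r K y c c' us ih hK hc hus
    have hyK : y ∉ K := fun hy ↦ lt_irrefl _ (hK.mem y hy).1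
    have htail : ∀ j : ℕ, nbrCount A (y - 1 - j) ≤ us.tail.getD j 3 := by
      intro j
      have := hus (j + 1)
      push_cast at this
      rw [show y - 1 - (j : ℤ) = y - (j + 1) by ring]
      cases us <;> simpa using this
    have hhead : nbrCount A y ≤ us.headD 3 := by
      have := hus 0
      cases us <;> simpa using this
    have e2 : y - 1 + 2 = y + 1 := by ring
    have e1 : y - 1 + 1 = y := by ring
    refine scanEvent_step_le h hhead (by positivity) ?_ ?_
    · have := ih (insert y K) (y - 1) _ us.tail (hK.succ (Or.inr rfl) hc) le_rfl htail
      rw [e2, e1, nbrCount_insert, indicator_insert_of_ne (show y + 1 ≠ y by omega)] at this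
      simpa using this
    · have := ih K (y - 1) _ us.tail (hK.succ (Or.inl rfl) hc) le_rfl htail
      rw [e2, e1, nbrCount_of_notMem hyK] at this
      simpa [hyK] using this
  intro t
  induction t with
  | leaf w =>
    intro r K y c us ht hK hc hus
    refine scanEvent_le_of_forall h hA (y + 2 - lo).toNat K y (by omega) fun B hB ↦ ?_
    have hlen := hK.length
    -- `K` lies above `y`, and the newly reached sites lie at or above `lo - 1`.
    refine ht (m + 1) e (min (y + 1) (lo - 1)) _ (fun x hx ↦ ?_) ⟨fun x hx ↦ ?_, fun j ↦ ?_⟩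
    · rcases hx with hx | hx
      · have := hK.mem x hx; omega
      · have := hB x hx; omega
    · rcases hx with hx | hx
      · exact (hK.mem x hx).2
      · have := hB x hx; omega
    · by_cases hj : j < r.length
      -- The word covers only positions from `y + 3` on, whose counts do not see the undecided sites
      -- up to `y`.
      · refine le_trans (le_of_eq (nbrCount_congr fun x h1 _ ↦ ?_)) (hK.le j hj)
        rw [Set.mem_union, or_iff_left]
        intro hx
        have := hB x hx
        omega
      · rw [List.getD_eq_default _ _ (by simpa using hj)]
        exact nbrCount_le_three _ _
  | skip t ih =>
    intro r K y c us ht hK hc hus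
    rw [scan_skip]
    exact hstep t r K y c 3 us (fun K y c us ↦ ih (3 :: r) K y c us ht) hK
      (nbrCount_le_three _ _) hus
  | node k lo' hi ihlo ihhi =>
    intro r K y c us ht hK hc hus
    by_cases hck : c ≤ k
    · rw [scan_node_of_le Q hck]
      exact hstep lo' r K y c k us (fun K y c us ↦ ihlo (k :: r) K y c us ht.1) hK
        (hc.trans hck) hus
    -- No letter is consumed here, so neither `r` nor `y` changes.
    · rw [scan_node_of_lt Q (not_le.1 hck)]
      exact ihhi r K y c us ht.2 hK hc hus

end Bounds

/-! ### Geometric decay from the finite check. -/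

section Decay

open WordTrie

variable {Ω : Type*} [MeasurableSpace Ω] {μ : Measure Ω} {R : ℕ → ℤ → ℤ → Set Ω} {Q : ℕ → ℕ}

/-- With the right edge at `y`, the first letter is the count at `y`. It is known once `y - 1` is
decided: `2` or `1`. -/
lemma scanEvent_le_edgeScan (h : IsExploration μ R Q) {z C : ℝ} (hz : 0 < z) (hC : 0 ≤ C)
    {n m : ℕ} {A : Set ℤ} {lo y : ℤ} (hA : ∀ x ∈ A, lo ≤ x) {root : WordTrie} {us : List ℕ}
    (hroot : AllLeaves (WeightBound μ R z C n) root [])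
    (hus : ∀ j : ℕ, nbrCount A (y - 1 - j) ≤ us.getD j 3) :
    μ.real (scanEvent R n m A {y} (y - 1)) ≤ C * z ^ y * edgeScan Q root us := by
  have htail : ∀ j : ℕ, nbrCount A (y - 2 - j) ≤ us.tail.getD j 3 := by
    intro j
    have := hus (j + 1)
    push_cast at this
    rw [show y - 2 - (j : ℤ) = y - 1 - (j + 1) by ring]
    cases us <;> simpa using this
  have hhead : nbrCount A (y - 1) ≤ us.headD 3 := by
    have := hus 0
    cases us <;> simpa using this
  rw [edgeScan_eq]
  have e2 : y - 2 + 2 = y := by ring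
  have e1 : y - 2 + 1 = y - 1 := by ring
  refine scanEvent_step_le h hhead (by positivity) ?_ ?_
  · rw [show y - 1 - 1 = y - 2 by ring]
    have hK : ScanInv (insert (y - 1) {y}) [] y (y - 2) := by
      refine ⟨fun x hx ↦ ?_, by simp, by simp⟩
      rcases hx with rfl | rfl <;> omega
    have := scanEvent_le_scan h hz hC hA root [] _ _ 2 us.tail hroot hK
      (by
        simp only [nbrCount, e2]
        have h1 : y + 1 ∉ ({y - 1, y} : Set ℤ) := by
          rintro (h1 | h1)
          · omega
          · simp at h1
        rw [Set.indicator_of_notMem h1]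
        have h2 := indicator_one_le {y - 1, y} (y - 1)
        have h3 := indicator_one_le {y - 1, y} y
        omega) htail (m := m)
    rw [e2, e1] at this
    simpa using this
  · rw [show y - 1 - 1 = y - 2 by ring]
    have hK : ScanInv {y} [] y (y - 2) := by
      refine ⟨fun x hx ↦ ?_, by simp, by simp⟩
      rw [Set.mem_singleton_iff] at hx
      omega
    have := scanEvent_le_scan h hz hC hA root [] _ _ 1 us.tail hroot hK
      (by simp [nbrCount]) htail (m := m)
    rw [e2, e1] at this
    simpa using this

/-- Either `y` is the new right edge, or the search moves on to `y - 1` and gains a factor `1 / z`.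
Where no bounds are left, `T` is a supersolution of this recursion by `hT`, which is propagated from
below `lo - 1`, where nothing is reached. -/
lemma scanEvent_le_firstScan (h : IsExploration μ R Q) {zn zd T n m : ℕ} {C : ℝ} (hzn : 0 < zn)
    (hzd : 0 < zd) (hC : 0 ≤ C) {A : Set ℤ} {lo : ℤ} (hA : ∀ x ∈ A, lo ≤ x) {root : WordTrie}
    (hT : avg (Q 3) (edgeScan Q root []) (shift zn zd T) ≤ T)
    (hroot : AllLeaves (WeightBound μ R ((zn : ℝ) / zd) C n) root []) :
    ∀ (us : List ℕ) (y : ℤ), (∀ j : ℕ, nbrCount A (y - j) ≤ us.getD j 3) →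
    μ.real (scanEvent R n m A ∅ y) ≤
      C * ((zn : ℝ) / zd) ^ y * firstScan Q root T zn zd us := by
  have hz : (0 : ℝ) < (zn : ℝ) / zd := by positivity
  have hstep : ∀ (us : List ℕ) (y : ℤ) (c v : ℕ), nbrCount A y ≤ c →
      (∀ j : ℕ, nbrCount A (y - 1 - j) ≤ us.getD j 3) →
      μ.real (scanEvent R n m A ∅ (y - 1)) ≤ C * ((zn : ℝ) / zd) ^ (y - 1) * v →
      μ.real (scanEvent R n m A ∅ y) ≤
        C * ((zn : ℝ) / zd) ^ y * avg (Q c) (edgeScan Q root us) (shift zn zd v) := by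
    intro us y c v hc hus hv
    refine scanEvent_step_le h hc (by positivity) ?_ (hv.trans ?_)
    · rw [insert_empty_eq]
      exact scanEvent_le_edgeScan h hz hC hA hroot hus
    · rw [zpow_sub_one₀ hz.ne', mul_assoc, mul_assoc, mul_assoc]
      refine mul_le_mul_of_nonneg_left (mul_le_mul_of_nonneg_left ?_ (by positivity)) hC
      refine le_trans (le_of_eq ?_) (div_le_shift hzn v)
      field_simp
  have hnil : ∀ (k : ℕ) (y : ℤ), y + 1 < lo + k →
      μ.real (scanEvent R n m A ∅ y) ≤ C * ((zn : ℝ) / zd) ^ y * T := by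
    have := h.isProbabilityMeasure
    have h0 : ∀ y : ℤ, y + 1 < lo →
        μ.real (scanEvent R n m A ∅ y) ≤ C * ((zn : ℝ) / zd) ^ y * T := by
      intro y hy
      have hemp : scanEvent R n m A ∅ y = ∅ :=
        Set.subset_empty_iff.1 fun ω hω ↦
          not_mem_hitEvent (A := constSet Ω ∅) (fun x hx ↦ (hx : x ∈ (∅ : Set ℤ))) (scanEvent_subset_of_lt hA hy hω)
      rw [hemp, measureReal_empty]
      positivity
    intro k
    induction k with
    | zero => exact fun y hy ↦ h0 y (by simpa using hy)
    | succ k ih =>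
      intro y hy
      refine (hstep [] y 3 T (nbrCount_le_three _ _)
        (fun j ↦ by simpa using nbrCount_le_three _ _) (ih _ (by push_cast at hy; omega))).trans ?_
      exact mul_le_mul_of_nonneg_left (by exact_mod_cast hT) (by positivity)
  intro us
  induction us with
  | nil => exact fun y _ ↦ hnil (y + 2 - lo).toNat y (by omega)
  | cons c us ih =>
    intro y hus
    have htail : ∀ j : ℕ, nbrCount A (y - 1 - j) ≤ us.getD j 3 := by
      intro j
      have := hus (j + 1)
      push_cast at this
      rw [show y - 1 - (j : ℤ) = y - (j + 1) by ring]
      simpa using this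
    exact hstep us y c _ (by simpa using hus 0) htail (ih (y - 1) htail)

/-- Induction on the number of levels, for all leaves at once, since one scan may end at any leaf.
-/
lemma allLeaves_weightBound (h : IsExploration μ R Q) {root : WordTrie} {T zn zd M : ℕ}
    (hzd : 0 < zd) (hz : zd ≤ zn) (hM : 0 < M) (hc : check Q root T zn zd M = true) (n : ℕ) :
    AllLeaves (WeightBound μ R ((zn : ℝ) / zd) ((((M - 1 : ℕ) : ℝ) / M) ^ n) n) root [] := by
  have := h.isProbabilityMeasure
  obtain ⟨hcT, hcl⟩ := (Bool.and_eq_true _ _).mp hc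
  have hT := Nat.le_of_ble_eq_true hcT
  have hl := allLeaves_of_checkLeaves hcl
  have hz0 : (0 : ℝ) < (zn : ℝ) / zd := by
    have : 0 < zn := by omega
    positivity
  have hz1 : (1 : ℝ) ≤ (zn : ℝ) / zd := by
    rw [one_le_div (by positivity)]
    exact_mod_cast hz
  induction n with
  | zero =>
    refine hl.imp fun r w hw m e lo A _ hA ↦ ?_
    have hw1 : 1 ≤ w := Nat.le_of_ble_eq_true ((Bool.and_eq_true _ _).mp hw).1
    -- For `e ≥ 0` the weight is at least `1`, because `z ≥ 1` and `w ≥ 1`; for `e < 0` the event is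
    -- empty.
    by_cases he : 0 ≤ e
    · refine measureReal_le_one.trans ?_
      rw [pow_zero, one_mul]
      exact one_le_mul_of_one_le_of_one_le (one_le_zpow₀ hz1 he) (by exact_mod_cast hw1)
    · have hemp : hitEvent R 0 m (constSet Ω A) = ∅ := by
        simp only [hitEvent, Set.iUnion_eq_empty]
        intro x hx
        have : x ∉ A := fun hxA ↦ he (hx.trans (hA.1 x hxA))
        simp [constSet, this]
      rw [hemp, measureReal_empty]
      positivity
  | succ n ih =>
    refine hl.imp fun r w hw m e lo A hlo hA ↦ ?_
    have hw2 := Nat.le_of_ble_eq_true ((Bool.and_eq_true _ _).mp hw).2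
    have hfirst := scanEvent_le_firstScan h (m := m) (by omega : 0 < zn) hzd (by positivity) hlo hT
      -- The extra letter `1` belongs to the site `e + 1`, whose only possibly occupied neighbour is
      -- `e`.
      ih (1 :: r.reverse) (e + 1) (by
        intro j
        cases j with
        | zero =>
          have h1 : e + 1 ∉ A := fun hx ↦ by have := hA.1 _ hx; omega
          have h2 : e + 1 + 1 ∉ A := fun hx ↦ by have := hA.1 _ hx; omega
          have h3 := indicator_one_le A (e + 1 - 1)
          simp only [nbrCount, Nat.cast_zero, sub_zero, Set.indicator_of_notMem h1,
            Set.indicator_of_notMem h2, List.getD_cons_zero]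
          omega
        | succ j =>
          have := hA.2 j
          push_cast
          rw [show e + 1 - ((j : ℤ) + 1) = e - j by ring]
          simpa using this)
    refine (measureReal_mono (hitEvent_succ_subset hA.1)).trans (hfirst.trans ?_)
    rw [zpow_add_one₀ hz0.ne', pow_succ]
    have hw3 : ((M : ℝ) * (zn * firstScan Q root T zn zd (1 :: r.reverse))) ≤
        ((M - 1 : ℕ) : ℝ) * (zd * w) := by exact_mod_cast hw2
    have hkey : (zn : ℝ) / zd * firstScan Q root T zn zd (1 :: r.reverse) ≤
        ((M - 1 : ℕ) : ℝ) / M * w := by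
      rw [div_mul_eq_mul_div, div_mul_eq_mul_div, div_le_div_iff₀ (by positivity) (by positivity)]
      linarith
    calc _ = (((M - 1 : ℕ) : ℝ) / M) ^ n * ((zn : ℝ) / zd) ^ e *
          ((zn : ℝ) / zd * firstScan Q root T zn zd (1 :: r.reverse)) := by ring
      _ ≤ (((M - 1 : ℕ) : ℝ) / M) ^ n * ((zn : ℝ) / zd) ^ e * (((M - 1 : ℕ) : ℝ) / M * w) :=
        mul_le_mul_of_nonneg_left hkey (by positivity)
      _ = _ := by ring

/-- The probability to reach `[0, ∞)` from the origin decays exponentially in the level. -/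
lemma measureReal_hitEvent_le (h : IsExploration μ R Q) {root : WordTrie} {T zn zd M : ℕ}
    (hzd : 0 < zd) (hz : zd ≤ zn) (hM : 0 < M) (hc : check Q root T zn zd M = true) (n : ℕ) :
    μ.real (hitEvent R (n + 1) 0 (constSet Ω {0})) ≤
      (((M - 1 : ℕ) : ℝ) / M) ^ n * ((zn : ℝ) / zd * T) := by
  have := h.isProbabilityMeasure
  have hT := Nat.le_of_ble_eq_true ((Bool.and_eq_true _ _).mp hc).1
  have hfirst := scanEvent_le_firstScan h (m := 0) (A := {0}) (lo := 0) (by omega : 0 < zn) hzd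
    (by positivity) (by simp) hT (allLeaves_weightBound h hzd hz hM hc n) [] (0 + 1)
    (fun j ↦ by simpa using nbrCount_le_three _ _)
  refine (measureReal_mono (hitEvent_succ_subset (by simp))).trans (hfirst.trans (le_of_eq ?_))
  simp [firstScan, mul_assoc]

end Decay

/-! ### The numerical certificates. -/

namespace WordTrie

/-- Bounds for the probability, in units of `10 ^ (-6)`, that a site is reached in site percolation
with parameter at most `0.525`, in terms of its number of neighbours. -/
def siteCap : ℕ → ℕ
  | 0 => 0
  | _ + 1 => 525000

/-- Bounds for the probability, in units of `10 ^ (-6)`, that a site is reached in bond percolation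
with parameter at most `0.4022`, in terms of its number of neighbours. -/
def bondCap : ℕ → ℕ
  | 0 => 0
  | 1 => 402200
  | 2 => 642636
  | _ + 3 => 786368

/-- A leaf of weight `10 ^ 9 + 10 ^ 3 k`. -/
def siteLeaf (k : ℕ) : WordTrie := leaf (1000000000 + 1000 * k)

/-- Distinguishes the letter `0` from the positive letters. -/
def node₀ (lo hi : WordTrie) : WordTrie := node 0 lo (skip hi)

/-- Weights for bond percolation. -/
def bondTrie : WordTrie :=
  -- Words of three letters. The first letter is `1` or `2` in every scan, so the last leaf, of
  -- empty word, is never entered.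
  node 1 (node 1 (node 0 (leaf 1000000) (node 1 (leaf 1001660) (node 2 (leaf 1002660) (skip (leaf
  1003250))))) (node 2 (node 0 (leaf 1002210) (node 1 (leaf 1003520) (node 2 (leaf 1004300) (skip
  (leaf 1004770))))) (skip (node 0 (leaf 1003530) (node 1 (leaf 1004630) (node 2 (leaf 1005290)
  (skip (leaf 1005680)))))))) (node 2 (node 1 (node 0 (leaf 1003590) (node 1 (leaf 1004820) (node
  2 (leaf 1005560) (skip (leaf 1006000))))) (node 2 (node 0 (leaf 1005270) (node 1 (leaf 1006250)
  (node 2 (leaf 1006830) (skip (leaf 1007180))))) (skip (node 0 (leaf 1006280) (node 1 (leaf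
  1007110) (node 2 (leaf 1007600) (skip (leaf 1007890)))))))) (leaf 1009220))

/-- Weights for site percolation. -/
def siteTrie : WordTrie :=
  -- Only the positivity of a letter matters for `siteCap`. The occupied edge makes the first two
  -- letters positive. A positive letter right after a `0` reveals an occupied site one step further
  -- left, so the next two letters are positive as well; this explains the pairs of `skip`.
  skip (skip (node₀ (node₀ (node₀ (node₀ (node₀ (node₀ (node₀ (node₀ (node₀ (node₀ (node₀ (node₀
  (node₀ (node₀ (node₀ (node₀ (node₀ (node₀ (node₀ (siteLeaf 0) (skip (skip (siteLeaf 283))))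
  (skip (skip (siteLeaf 645)))) (skip (skip (siteLeaf 1066)))) (skip (skip (siteLeaf 1531))))
  (skip (skip (siteLeaf 2031)))) (skip (skip (siteLeaf 2558)))) (skip (skip (siteLeaf 3103))))
  (skip (skip (siteLeaf 3663)))) (skip (skip (siteLeaf 4230)))) (skip (skip (siteLeaf 4799))))
  (skip (skip (siteLeaf 5364)))) (skip (skip (node₀ (siteLeaf 5847) (siteLeaf 5919))))) (skip
  (skip (node₀ (siteLeaf 6380) (siteLeaf 6456))))) (skip (skip (node₀ (node₀ (node₀ (siteLeaf
  6697) (skip (skip (siteLeaf 6796)))) (skip (skip (siteLeaf 6888)))) (siteLeaf 6968))))) (skip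
  (skip (node₀ (node₀ (node₀ (node₀ (siteLeaf 7029) (skip (skip (siteLeaf 7145)))) (skip (skip
  (siteLeaf 7262)))) (skip (skip (siteLeaf 7365)))) (node₀ (siteLeaf 7398) (siteLeaf 7448))))))
  (skip (skip (node₀ (node₀ (node₀ (node₀ (node₀ (node₀ (node₀ (siteLeaf 6991) (skip (skip
  (siteLeaf 7119)))) (skip (skip (siteLeaf 7257)))) (skip (skip (siteLeaf 7403)))) (skip (skip
  (siteLeaf 7549)))) (skip (skip (siteLeaf 7687)))) (skip (skip (siteLeaf 7800)))) (node₀ (node₀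
  (node₀ (node₀ (siteLeaf 7584) (skip (skip (siteLeaf 7671)))) (skip (skip (siteLeaf 7757))))
  (skip (skip (siteLeaf 7830)))) (node₀ (node₀ (siteLeaf 7805) (skip (skip (siteLeaf 7850))))
  (siteLeaf 7886))))))) (skip (skip (node₀ (node₀ (node₀ (node₀ (node₀ (node₀ (node₀ (node₀
  (node₀ (siteLeaf 6886) (skip (skip (siteLeaf 7038)))) (skip (skip (siteLeaf 7202)))) (skip
  (skip (siteLeaf 7381)))) (skip (skip (siteLeaf 7566)))) (skip (skip (siteLeaf 7749)))) (skip
  (skip (siteLeaf 7920)))) (skip (skip (siteLeaf 8072)))) (skip (skip (siteLeaf 8189)))) (node₀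
  (node₀ (node₀ (node₀ (node₀ (node₀ (siteLeaf 7664) (skip (skip (siteLeaf 7781)))) (skip (skip
  (siteLeaf 7902)))) (skip (skip (siteLeaf 8021)))) (skip (skip (siteLeaf 8129)))) (skip (skip
  (siteLeaf 8214)))) (node₀ (node₀ (node₀ (node₀ (node₀ (siteLeaf 7951) (skip (skip (siteLeaf
  8026)))) (skip (skip (siteLeaf 8101)))) (skip (skip (siteLeaf 8173)))) (skip (skip (siteLeaf
  8231)))) (node₀ (node₀ (siteLeaf 8207) (skip (skip (siteLeaf 8245)))) (siteLeaf 8274))))))))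
  (skip (skip (node₀ (node₀ (node₀ (node₀ (node₀ (node₀ (node₀ (node₀ (node₀ (node₀ (node₀ (node₀
  (siteLeaf 6396) (skip (skip (siteLeaf 6555)))) (skip (skip (siteLeaf 6733)))) (skip (skip
  (siteLeaf 6930)))) (skip (skip (siteLeaf 7142)))) (skip (skip (siteLeaf 7365)))) (skip (skip
  (siteLeaf 7592)))) (skip (skip (siteLeaf 7814)))) (skip (skip (siteLeaf 8024)))) (skip (skip
  (siteLeaf 8214)))) (skip (skip (siteLeaf 8376)))) (skip (skip (siteLeaf 8496)))) (node₀ (node₀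
  (node₀ (node₀ (node₀ (node₀ (node₀ (node₀ (node₀ (siteLeaf 7389) (skip (skip (siteLeaf 7527))))
  (skip (skip (siteLeaf 7677)))) (skip (skip (siteLeaf 7837)))) (skip (skip (siteLeaf 7999))))
  (skip (skip (siteLeaf 8157)))) (skip (skip (siteLeaf 8302)))) (skip (skip (siteLeaf 8426))))
  (skip (skip (siteLeaf 8518)))) (node₀ (node₀ (node₀ (node₀ (node₀ (node₀ (node₀ (siteLeaf 7942)
  (skip (skip (siteLeaf 8045)))) (skip (skip (siteLeaf 8154)))) (skip (skip (siteLeaf 8264))))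
  (skip (skip (siteLeaf 8370)))) (skip (skip (siteLeaf 8463)))) (skip (skip (siteLeaf 8533))))
  (node₀ (node₀ (node₀ (node₀ (node₀ (node₀ (siteLeaf 8218) (skip (skip (siteLeaf 8287)))) (skip
  (skip (siteLeaf 8359)))) (skip (skip (siteLeaf 8429)))) (skip (skip (siteLeaf 8494)))) (skip
  (skip (siteLeaf 8545)))) (node₀ (node₀ (node₀ (siteLeaf 8478) (skip (skip (siteLeaf 8520))))
  (skip (skip (siteLeaf 8555)))) (siteLeaf 8581))))))))) (node₀ (node₀ (node₀ (node₀ (node₀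
  (node₀ (node₀ (node₀ (node₀ (node₀ (node₀ (node₀ (node₀ (node₀ (node₀ (node₀ (node₀ (siteLeaf
  2692) (skip (skip (siteLeaf 2952)))) (skip (skip (siteLeaf 3266)))) (skip (skip (siteLeaf
  3620)))) (skip (skip (siteLeaf 4006)))) (skip (skip (siteLeaf 4417)))) (skip (skip (siteLeaf
  4845)))) (skip (skip (siteLeaf 5285)))) (skip (skip (siteLeaf 5732)))) (skip (skip (siteLeaf
  6178)))) (skip (skip (siteLeaf 6618)))) (skip (skip (siteLeaf 7043)))) (skip (skip (node₀
  (siteLeaf 7387) (siteLeaf 7446))))) (skip (skip (node₀ (node₀ (siteLeaf 7685) (skip (skip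
  (siteLeaf 7757)))) (siteLeaf 7820))))) (skip (skip (node₀ (node₀ (node₀ (node₀ (siteLeaf 7817)
  (skip (skip (siteLeaf 7912)))) (skip (skip (siteLeaf 8007)))) (skip (skip (siteLeaf 8088))))
  (siteLeaf 8154))))) (skip (skip (node₀ (node₀ (node₀ (node₀ (node₀ (node₀ (siteLeaf 7800) (skip
  (skip (siteLeaf 7920)))) (skip (skip (siteLeaf 8047)))) (skip (skip (siteLeaf 8171)))) (skip
  (skip (siteLeaf 8284)))) (skip (skip (siteLeaf 8375)))) (node₀ (node₀ (node₀ (siteLeaf 8261)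
  (skip (skip (siteLeaf 8335)))) (skip (skip (siteLeaf 8396)))) (node₀ (siteLeaf 8411) (siteLeaf
  8441))))))) (skip (skip (node₀ (node₀ (node₀ (node₀ (node₀ (node₀ (node₀ (node₀ (node₀
  (siteLeaf 7450) (skip (skip (siteLeaf 7589)))) (skip (skip (siteLeaf 7740)))) (skip (skip
  (siteLeaf 7901)))) (skip (skip (siteLeaf 8065)))) (skip (skip (siteLeaf 8224)))) (skip (skip
  (siteLeaf 8371)))) (skip (skip (siteLeaf 8499)))) (skip (skip (siteLeaf 8594)))) (node₀ (node₀
  (node₀ (node₀ (node₀ (node₀ (siteLeaf 8120) (skip (skip (siteLeaf 8229)))) (skip (skip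
  (siteLeaf 8339)))) (skip (skip (siteLeaf 8445)))) (skip (skip (siteLeaf 8539)))) (skip (skip
  (siteLeaf 8611)))) (node₀ (node₀ (node₀ (node₀ (node₀ (siteLeaf 8367) (skip (skip (siteLeaf
  8437)))) (skip (skip (siteLeaf 8507)))) (skip (skip (siteLeaf 8572)))) (skip (skip (siteLeaf
  8623)))) (node₀ (node₀ (siteLeaf 8599) (skip (skip (siteLeaf 8634)))) (siteLeaf 8660))))))))
  (node₀ (node₀ (node₀ (node₀ (node₀ (node₀ (node₀ (node₀ (node₀ (node₀ (node₀ (node₀ (node₀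
  (node₀ (node₀ (node₀ (node₀ (siteLeaf 4265) (skip (skip (siteLeaf 4397)))) (skip (skip
  (siteLeaf 4587)))) (skip (skip (siteLeaf 4822)))) (skip (skip (siteLeaf 5092)))) (skip (skip
  (siteLeaf 5391)))) (skip (skip (siteLeaf 5712)))) (skip (skip (siteLeaf 6048)))) (skip (skip
  (siteLeaf 6395)))) (skip (skip (siteLeaf 6746)))) (skip (skip (siteLeaf 7095)))) (skip (skip
  (siteLeaf 7435)))) (skip (skip (siteLeaf 7758)))) (skip (skip (node₀ (siteLeaf 8010) (siteLeaf
  8056))))) (skip (skip (node₀ (node₀ (node₀ (siteLeaf 8151) (skip (skip (siteLeaf 8213)))) (skip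
  (skip (siteLeaf 8270)))) (siteLeaf 8319))))) (skip (skip (node₀ (node₀ (node₀ (node₀ (node₀
  (siteLeaf 8178) (skip (skip (siteLeaf 8259)))) (skip (skip (siteLeaf 8342)))) (skip (skip
  (siteLeaf 8423)))) (skip (skip (siteLeaf 8489)))) (node₀ (node₀ (siteLeaf 8466) (skip (skip
  (siteLeaf 8508)))) (siteLeaf 8541)))))) (skip (skip (node₀ (node₀ (node₀ (node₀ (node₀ (node₀
  (node₀ (node₀ (siteLeaf 7944) (skip (skip (siteLeaf 8041)))) (skip (skip (siteLeaf 8146))))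
  (skip (skip (siteLeaf 8258)))) (skip (skip (siteLeaf 8372)))) (skip (skip (siteLeaf 8480))))
  (skip (skip (siteLeaf 8578)))) (skip (skip (siteLeaf 8652)))) (node₀ (node₀ (node₀ (node₀
  (node₀ (siteLeaf 8404) (skip (skip (siteLeaf 8476)))) (skip (skip (siteLeaf 8547)))) (skip
  (skip (siteLeaf 8614)))) (skip (skip (siteLeaf 8667)))) (node₀ (node₀ (node₀ (siteLeaf 8600)
  (skip (skip (siteLeaf 8643)))) (skip (skip (siteLeaf 8678)))) (siteLeaf 8705))))))) (node₀
  (node₀ (node₀ (node₀ (node₀ (node₀ (node₀ (node₀ (node₀ (node₀ (node₀ (node₀ (node₀ (node₀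
  (node₀ (siteLeaf 5664) (skip (skip (siteLeaf 5803)))) (skip (skip (siteLeaf 5977)))) (skip
  (skip (siteLeaf 6180)))) (skip (skip (siteLeaf 6405)))) (skip (skip (siteLeaf 6651)))) (skip
  (skip (siteLeaf 6912)))) (skip (skip (siteLeaf 7181)))) (skip (skip (siteLeaf 7454)))) (skip
  (skip (siteLeaf 7723)))) (skip (skip (siteLeaf 7980)))) (skip (skip (siteLeaf 8219)))) (skip
  (skip (node₀ (siteLeaf 8394) (siteLeaf 8430))))) (skip (skip (node₀ (node₀ (node₀ (siteLeaf
  8466) (skip (skip (siteLeaf 8519)))) (skip (skip (siteLeaf 8567)))) (siteLeaf 8605))))) (skip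
  (skip (node₀ (node₀ (node₀ (node₀ (node₀ (node₀ (siteLeaf 8345) (skip (skip (siteLeaf 8417))))
  (skip (skip (siteLeaf 8492)))) (skip (skip (siteLeaf 8566)))) (skip (skip (siteLeaf 8636))))
  (skip (skip (siteLeaf 8692)))) (node₀ (node₀ (node₀ (siteLeaf 8624) (skip (skip (siteLeaf
  8668)))) (skip (skip (siteLeaf 8705)))) (siteLeaf 8732)))))) (node₀ (node₀ (node₀ (node₀ (node₀
  (node₀ (node₀ (node₀ (node₀ (node₀ (node₀ (node₀ (node₀ (node₀ (siteLeaf 6629) (skip (skip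
  (siteLeaf 6725)))) (skip (skip (siteLeaf 6849)))) (skip (skip (siteLeaf 6996)))) (skip (skip
  (siteLeaf 7162)))) (skip (skip (siteLeaf 7345)))) (skip (skip (siteLeaf 7541)))) (skip (skip
  (siteLeaf 7745)))) (skip (skip (siteLeaf 7951)))) (skip (skip (siteLeaf 8152)))) (skip (skip
  (siteLeaf 8342)))) (skip (skip (siteLeaf 8510)))) (skip (skip (node₀ (siteLeaf 8622) (siteLeaf
  8650))))) (skip (skip (node₀ (node₀ (node₀ (node₀ (siteLeaf 8586) (skip (skip (siteLeaf
  8635)))) (skip (skip (siteLeaf 8681)))) (skip (skip (siteLeaf 8721)))) (siteLeaf 8751)))))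
  (node₀ (node₀ (node₀ (node₀ (node₀ (node₀ (node₀ (node₀ (node₀ (node₀ (node₀ (node₀ (node₀
  (siteLeaf 7346) (skip (skip (siteLeaf 7412)))) (skip (skip (siteLeaf 7499)))) (skip (skip
  (siteLeaf 7604)))) (skip (skip (siteLeaf 7723)))) (skip (skip (siteLeaf 7854)))) (skip (skip
  (siteLeaf 7997)))) (skip (skip (siteLeaf 8146)))) (skip (skip (siteLeaf 8296)))) (skip (skip
  (siteLeaf 8441)))) (skip (skip (siteLeaf 8573)))) (skip (skip (siteLeaf 8684)))) (skip (skip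
  (node₀ (node₀ (siteLeaf 8717) (skip (skip (siteLeaf 8743)))) (siteLeaf 8765))))) (node₀ (node₀
  (node₀ (node₀ (node₀ (node₀ (node₀ (node₀ (node₀ (node₀ (node₀ (siteLeaf 7917) (skip (skip
  (siteLeaf 7975)))) (skip (skip (siteLeaf 8047)))) (skip (skip (siteLeaf 8130)))) (skip (skip
  (siteLeaf 8222)))) (skip (skip (siteLeaf 8321)))) (skip (skip (siteLeaf 8425)))) (skip (skip
  (siteLeaf 8529)))) (skip (skip (siteLeaf 8627)))) (skip (skip (siteLeaf 8713)))) (skip (skip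
  (siteLeaf 8776)))) (node₀ (node₀ (node₀ (node₀ (node₀ (node₀ (node₀ (node₀ (node₀ (node₀
  (siteLeaf 8272) (skip (skip (siteLeaf 8310)))) (skip (skip (siteLeaf 8357)))) (skip (skip
  (siteLeaf 8412)))) (skip (skip (siteLeaf 8474)))) (skip (skip (siteLeaf 8541)))) (skip (skip
  (siteLeaf 8609)))) (skip (skip (siteLeaf 8677)))) (skip (skip (siteLeaf 8738)))) (skip (skip
  (siteLeaf 8785)))) (node₀ (node₀ (node₀ (node₀ (node₀ (node₀ (node₀ (node₀ (siteLeaf 8530)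
  (skip (skip (siteLeaf 8559)))) (skip (skip (siteLeaf 8594)))) (skip (skip (siteLeaf 8634))))
  (skip (skip (siteLeaf 8677)))) (skip (skip (siteLeaf 8720)))) (skip (skip (siteLeaf 8761))))
  (skip (skip (siteLeaf 8794)))) (node₀ (node₀ (node₀ (node₀ (node₀ (node₀ (siteLeaf 8682) (skip
  (skip (siteLeaf 8704)))) (skip (skip (siteLeaf 8728)))) (skip (skip (siteLeaf 8754)))) (skip
  (skip (siteLeaf 8780)))) (skip (skip (siteLeaf 8801)))) (node₀ (node₀ (node₀ (node₀ (siteLeaf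
  8765) (skip (skip (siteLeaf 8779)))) (skip (skip (siteLeaf 8794)))) (skip (skip (siteLeaf
  8807)))) (node₀ (node₀ (siteLeaf 8804) (skip (skip (siteLeaf 8811)))) (node₀ (siteLeaf 8814)
  (siteLeaf 8818)))))))))))))))

/-- Here `z = 1.01`, and the expected weight shrinks by at least the factor `1 - 10 ^ (-5)` per
level. -/
lemma check_bondTrie : check bondCap bondTrie 1004025 101 100 100000 = true := by
  decide +kernel

/-- Here `z = 1.0015`, and the factor is `1 - 10 ^ (-6)`. -/
lemma check_siteTrie : check siteCap siteTrie 1007303378 2003 2000 1000000 = true := by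
  decide +kernel

end WordTrie

/-! ### Site and bond percolation as explorations. -/

section Models

open WordTrie

variable {Ω : Type*}

/-- An open path that ends at a site `x ≥ 0` witnesses `hitEvent`. -/
lemma mem_hitEvent_of_path {R : ℕ → ℤ → ℤ → Set Ω} {ω : Ω} {x : ℕ → ℤ}
    (hx : ∀ k, ∃ d, (d = -1 ∨ d = 0 ∨ d = 1) ∧ x k = x (k + 1) + d ∧ ω ∈ R k (x (k + 1)) d) :
    ∀ (n m : ℕ) (A : ℤ → Set Ω), ω ∈ A (x m) → 0 ≤ x (m + n) → ω ∈ hitEvent R n m A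
  | 0, m, A, hA, h0 => Set.mem_iUnion₂.2 ⟨x m, h0, hA⟩
  | n + 1, m, A, hA, h0 => by
    refine mem_hitEvent_of_path hx n (m + 1) _ ?_ (by rwa [add_right_comm, add_assoc])
    obtain ⟨d, hd, hxd, hR⟩ := hx m
    rw [hxd] at hA
    rcases hd with rfl | rfl | rfl
    · exact Or.inl (Or.inl ⟨hA, hR⟩)
    · exact Or.inl (Or.inr ⟨by simpa using hA, hR⟩)
    · exact Or.inr ⟨hA, hR⟩

/-- `R` and `R'` stand for the exploration and its mirror image; a union bound over the two
half-lines suffices. Measurability of `E` is not needed. -/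
lemma measure_eq_zero_of_explorations [MeasurableSpace Ω] {μ : Measure Ω}
    {R R' : ℕ → ℤ → ℤ → Set Ω} {Q : ℕ → ℕ} (h : IsExploration μ R Q) (h' : IsExploration μ R' Q)
    {root : WordTrie} {T zn zd M : ℕ} (hzd : 0 < zd) (hz : zd ≤ zn) (hM : 0 < M)
    (hc : check Q root T zn zd M = true) {E : Set Ω}
    (hE : ∀ n, E ⊆ hitEvent R (n + 1) 0 (constSet Ω {0}) ∪
      hitEvent R' (n + 1) 0 (constSet Ω {0})) : μ E = 0 := by
  have := h.isProbabilityMeasure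
  have hle : ∀ n : ℕ, μ.real E ≤
      (((M - 1 : ℕ) : ℝ) / M) ^ n * (2 * ((zn : ℝ) / zd * T)) := by
    intro n
    have h1 := measureReal_hitEvent_le h hzd hz hM hc n
    have h2 := measureReal_hitEvent_le h' hzd hz hM hc n
    have h3 := (measureReal_mono (μ := μ) (hE n)).trans (measureReal_union_le _ _)
    linarith
  have hlt : ((M - 1 : ℕ) : ℝ) / M < 1 := by
    rw [div_lt_one (by positivity)]
    exact_mod_cast Nat.sub_lt hM one_pos
  have hlim := (tendsto_pow_atTop_nhds_zero_of_lt_one (by positivity) hlt).mul_const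
    (2 * ((zn : ℝ) / zd * T))
  rw [zero_mul] at hlim
  exact (measureReal_eq_zero_iff).1 (le_antisymm (ge_of_tendsto' hlim hle) measureReal_nonneg)

lemma nextSet_subset (R : ℕ → ℤ → ℤ → Set Ω) (m : ℕ) (A : ℤ → Set Ω) (x : ℤ) :
    nextSet R m A x ⊆ R m x (-1) ∪ R m x 0 ∪ R m x 1 :=
  Set.union_subset_union (Set.union_subset_union Set.inter_subset_right Set.inter_subset_right)
    Set.inter_subset_right

lemma nextSet_eq_empty (R : ℕ → ℤ → ℤ → Set Ω) (m : ℕ) {A : Set ℤ} {x : ℤ}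
    (h : nbrCount A x = 0) : nextSet R m (constSet Ω A) x = ∅ := by
  have h' : ∀ z, A.indicator (1 : ℤ → ℕ) z = 0 → z ∉ A := by
    intro z hz hzA
    simp [hzA] at hz
  unfold nbrCount at h
  have h1 := h' (x - 1) (by omega)
  have h2 := h' x (by omega)
  have h3 := h' (x + 1) (by omega)
  simp [nextSet, constSet, h1, h2, h3]

/-- The steps of site percolation, reflected if `s = -1`. -/
def siteStep (s : ℤ) (m : ℕ) (x _d : ℤ) : Set (Set (ℤ × ℤ)) := {ω | (s * x, (m : ℤ) + 1) ∈ ω}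

/-- The steps of bond percolation, reflected if `s = -1`. -/
def bondStep (s : ℤ) (m : ℕ) (x d : ℤ) : Set (Set ((ℤ × ℤ) × (ℤ × ℤ))) :=
  {ω | ((s * (x + d), (m : ℤ)), (s * x, (m : ℤ) + 1)) ∈ ω}

lemma isExploration_siteStep {p : I} (hp : (p : ℝ) ≤ 0.525) {s : ℤ} (hs : s ≠ 0) :
    IsExploration (altSiteLaw p) (siteStep s) siteCap where
  exists_key := by
    refine ⟨ℤ × ℤ, fun i ↦ {ω | i ∈ ω}, fun m x _ ↦ (s * x, (m : ℤ) + 1),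
      measurableSet_setOf_mem, iIndepSet_setBernoulli _ p, fun m x d m' x' d' h ↦ ?_,
      fun m x d ↦ rfl⟩
    rw [Prod.mk.injEq] at h
    exact ⟨by omega, mul_left_cancel₀ hs h.1⟩
  prob_le m A x c hc := by
    have : IsProbabilityMeasure (altSiteLaw p) :=
      inferInstanceAs (IsProbabilityMeasure (setBernoulli _ p))
    rcases c with _ | c
    · rw [nextSet_eq_empty _ _ (Nat.le_zero.1 hc)]
      simp [siteCap]
    · have hsub : nextSet (siteStep s) m (constSet _ A) x ⊆ {ω | (s * x, (m : ℤ) + 1) ∈ ω} :=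
        (nextSet_subset _ _ _ _).trans (by simp [siteStep])
      refine (measureReal_mono hsub).trans ?_
      rw [altSiteLaw, setBernoulli_real_mem (Set.mem_univ _)]
      norm_num [siteCap] at hp ⊢
      linarith
  cap_le c := by
    rcases c with _ | c <;> norm_num [siteCap]

open scoped Classical in
lemma nbrCount_eq_card (A : Set ℤ) (x : ℤ) :
    nbrCount A x = (({-1, 0, 1} : Finset ℤ).filter fun d ↦ x + d ∈ A).card := by
  unfold nbrCount
  rw [Finset.card_filter]
  rw [Finset.sum_insert (by decide), Finset.sum_insert (by decide), Finset.sum_singleton]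
  simp [Set.indicator_apply, sub_eq_add_neg, add_assoc]

lemma measureReal_biInter_compl_of_iIndepSet {ι : Type*} [MeasurableSpace Ω] {μ : Measure Ω}
    {O : ι → Set Ω} (h : iIndepSet O μ) (hO : ∀ i, MeasurableSet (O i)) {p : ℝ} (S : Finset ι)
    (hp : ∀ i ∈ S, μ.real (O i) = p) : μ.real (⋂ i ∈ S, (O i)ᶜ) = (1 - p) ^ S.card := by
  have := h.isProbabilityMeasure
  have h1 := ((iIndepSet_iff_iIndep O μ).1 h).meas_biInter (S := S) (s := fun i ↦ (O i)ᶜ)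
    fun i _ ↦ (MeasurableSpace.measurableSet_generateFrom (Set.mem_singleton (O i))).compl
  rw [Measure.real, h1, ENNReal.toReal_prod, ← Finset.prod_const]
  refine Finset.prod_congr rfl fun i hi ↦ ?_
  rw [← hp i hi, ← probReal_compl_eq_one_sub (hO i), Measure.real]

lemma isExploration_bondStep {p : I} (hp : (p : ℝ) ≤ 0.4022) {s : ℤ} (hs : s = 1 ∨ s = -1) :
    IsExploration (altBondLaw p) (bondStep s) bondCap where
  exists_key := by
    refine ⟨(ℤ × ℤ) × (ℤ × ℤ), fun i ↦ {ω | i ∈ ω},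
      fun m x d ↦ ((s * (x + d), (m : ℤ)), (s * x, (m : ℤ) + 1)),
      measurableSet_setOf_mem, iIndepSet_setBernoulli _ p, fun m x d m' x' d' h ↦ ?_,
      fun m x d ↦ rfl⟩
    simp only [Prod.mk.injEq] at h
    exact ⟨by omega, mul_left_cancel₀ (by omega) h.2.1⟩
  prob_le m A x c hc := by
    classical
    have : IsProbabilityMeasure (altBondLaw p) :=
      inferInstanceAs (IsProbabilityMeasure (setBernoulli _ p))
    set key : ℤ → (ℤ × ℤ) × (ℤ × ℤ) := fun d ↦ ((s * (x + d), (m : ℤ)), (s * x, (m : ℤ) + 1))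
    have hkey : Function.Injective key := by
      intro d d' h
      simp only [key, Prod.mk.injEq] at h
      have := mul_left_cancel₀ (show s ≠ 0 by omega) h.1.1
      omega
    set S := (({-1, 0, 1} : Finset ℤ).filter fun d ↦ x + d ∈ A).image key
    have hcard : S.card = nbrCount A x := by
      rw [nbrCount_eq_card, Finset.card_image_of_injective _ hkey]
    have hS : ∀ i ∈ S, (altBondLaw p).real {ω | i ∈ ω} = p := by
      intro i hi
      obtain ⟨d, hd, rfl⟩ := Finset.mem_image.1 hi
      refine setBernoulli_real_mem ?_ p
      have hd' := (Finset.mem_filter.1 hd).1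
      simp only [Finset.mem_insert, Finset.mem_singleton] at hd'
      simp only [altLattice, key, Set.mem_ofPred_eq, Prod.mk.injEq, and_true]
      rcases hs with rfl | rfl <;> omega
    -- If all edges from `A` into the site are closed, it is not reached; this has probability `(1 -
    -- p) ^ nbrCount A x`.
    have hcompl : (⋂ i ∈ S, {ω : Set ((ℤ × ℤ) × (ℤ × ℤ)) | i ∈ ω}ᶜ) ⊆
        (nextSet (bondStep s) m (constSet _ A) x)ᶜ := by
      intro ω hω hmem
      have hnot : ∀ d, (d = -1 ∨ d = 0 ∨ d = 1) → x + d ∈ A → key d ∉ ω := by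
        intro d hd hdA
        exact Set.mem_iInter₂.1 hω (key d)
          (Finset.mem_image_of_mem _ (Finset.mem_filter.2 ⟨by simpa using hd, hdA⟩))
      rcases hmem with (h | h) | h
      · exact hnot (-1) (by simp) h.1 h.2
      · exact hnot 0 (by simp) (by simpa using (show x ∈ A from h.1)) h.2
      · exact hnot 1 (by simp) h.1 h.2
    have hmeas : MeasurableSet (nextSet (bondStep s) m (constSet _ A) x) :=
      measurableSet_nextSet (measurableSet_constSet A) fun d ↦ measurableSet_setOf_mem _
    have h1 := measureReal_mono (μ := altBondLaw p) hcompl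
    have hind : iIndepSet (fun i ↦ {ω : Set ((ℤ × ℤ) × (ℤ × ℤ)) | i ∈ ω}) (altBondLaw p) :=
      iIndepSet_setBernoulli _ p
    rw [measureReal_biInter_compl_of_iIndepSet hind measurableSet_setOf_mem S hS, hcard,
      probReal_compl_eq_one_sub hmeas] at h1
    have hp0 : (0 : ℝ) ≤ p := p.2.1
    have hq : (0.5978 : ℝ) ≤ 1 - p := by linarith
    have hq1 : 1 - (p : ℝ) ≤ 1 := by linarith
    have h2 : (1 - (p : ℝ)) ^ min c 3 ≤ (1 - (p : ℝ)) ^ nbrCount A x :=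
      pow_le_pow_of_le_one (by linarith) hq1 (le_min hc (nbrCount_le_three _ _))
    have h3 : (0.5978 : ℝ) ^ min c 3 ≤ (1 - (p : ℝ)) ^ min c 3 :=
      pow_le_pow_left₀ (by norm_num) hq _
    -- `0.5978 = 1 - 0.4022`, and the values of `bondCap` are these probabilities rounded up.
    have h4 : 1 - (0.5978 : ℝ) ^ min c 3 ≤ (bondCap c : ℝ) / 10 ^ 6 := by
      rcases c with _ | _ | _ | c
      · norm_num [bondCap]
      · norm_num [bondCap]
      · norm_num [bondCap]
      · rw [min_eq_right (by omega)]
        norm_num [bondCap]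
    linarith
  cap_le c := by
    rcases c with _ | _ | _ | c <;> norm_num [bondCap]

/-- The horizontal displacement along a step of the lattice. -/
lemma altLattice_adj_snd {v w : ℤ × ℤ} (h : altLattice.Adj v w) :
    w.2 = v.2 + 1 ∧ (v.1 - w.1 = -1 ∨ v.1 - w.1 = 0 ∨ v.1 - w.1 = 1) := by
  rcases h with rfl | rfl | rfl <;> simp

lemma IsInfinitePathFrom.snd_eq {γ : ℕ → ℤ × ℤ}
    (h : IsInfinitePathFrom altLattice (0, 0) γ) (n : ℕ) : (γ n).2 = n := by
  induction n with
  | zero => simp [h.1]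
  | succ n ih => rw [(altLattice_adj_snd (h.2 n)).1, ih]; push_cast; rfl

/-- If, for both signs, the open paths are paths of the reflected exploration, then percolation
implies that `[0, ∞)` is reached in one of the two explorations. -/
lemma IsInfinitePathFrom.mem_hitEvent {R R' : ℕ → ℤ → ℤ → Set Ω} {ω : Ω} {γ : ℕ → ℤ × ℤ}
    (h : IsInfinitePathFrom altLattice (0, 0) γ)
    (hR : ∀ k d, (γ k).1 = (γ (k + 1)).1 + d → ω ∈ R k (γ (k + 1)).1 d)
    (hR' : ∀ k d, (γ k).1 = (γ (k + 1)).1 + d → ω ∈ R' k (-(γ (k + 1)).1) (-d)) (n : ℕ) :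
    ω ∈ hitEvent R n 0 (constSet Ω {0}) ∪ hitEvent R' n 0 (constSet Ω {0}) := by
  have h0 : (γ 0).1 = 0 := by rw [h.1]
  rcases le_total 0 (γ n).1 with hn | hn
  · refine Or.inl (mem_hitEvent_of_path (x := fun k ↦ (γ k).1) (fun k ↦ ?_) n 0 _ h0 (by simpa))
    exact ⟨(γ k).1 - (γ (k + 1)).1, (altLattice_adj_snd (h.2 k)).2, by ring, hR k _ (by ring)⟩
  · refine Or.inr (mem_hitEvent_of_path (x := fun k ↦ -(γ k).1) (fun k ↦ ?_) n 0 _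
      (show -(γ 0).1 = 0 by rw [h0, neg_zero]) (by simpa))
    refine ⟨-((γ k).1 - (γ (k + 1)).1), ?_, by ring, hR' k _ (by ring)⟩
    have := (altLattice_adj_snd (h.2 k)).2
    omega

lemma altSiteLaw_percolates_eq_zero {p : I} (hp : (p : ℝ) ≤ 0.525) :
    altSiteLaw p altSitePercolates = 0 := by
  refine measure_eq_zero_of_explorations (isExploration_siteStep hp one_ne_zero)
    (isExploration_siteStep hp (s := -1) (by norm_num)) (by norm_num) (by norm_num) (by norm_num)
    check_siteTrie fun n ω hω ↦ ?_
  obtain ⟨γ, hγ, hω⟩ := hω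
  have hmem : ∀ k, ((γ (k + 1)).1, (k : ℤ) + 1) ∈ ω := by
    intro k
    have := hω (k + 1)
    rwa [← Prod.mk.eta (p := γ (k + 1)), hγ.snd_eq (k + 1), Nat.cast_add_one] at this
  refine hγ.mem_hitEvent (fun k d _ ↦ ?_) (fun k d _ ↦ ?_) (n + 1)
  · simpa [siteStep] using hmem k
  · simpa [siteStep] using hmem k

lemma altBondLaw_percolates_eq_zero {p : I} (hp : (p : ℝ) ≤ 0.4022) :
    altBondLaw p altBondPercolates = 0 := by
  refine measure_eq_zero_of_explorations (isExploration_bondStep hp (Or.inl rfl))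
    (isExploration_bondStep hp (Or.inr rfl)) (by norm_num) (by norm_num) (by norm_num)
    check_bondTrie fun n ω hω ↦ ?_
  obtain ⟨γ, hγ, hω⟩ := hω
  have hmem : ∀ k, (((γ k).1, (k : ℤ)), ((γ (k + 1)).1, (k : ℤ) + 1)) ∈ ω := by
    intro k
    have := hω k
    rwa [← Prod.mk.eta (p := γ (k + 1)), ← Prod.mk.eta (p := γ k), hγ.snd_eq (k + 1),
      hγ.snd_eq k, Nat.cast_add_one] at this
  refine hγ.mem_hitEvent (fun k d hd ↦ ?_) (fun k d hd ↦ ?_) (n + 1)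
  · have := hmem k
    rw [hd] at this
    simpa [bondStep] using this
  · have := hmem k
    rw [hd] at this
    simpa [bondStep, add_comm] using this

lemma isInfinitePathFrom_vertical :
    IsInfinitePathFrom altLattice (0, 0) fun n : ℕ ↦ (0, (n : ℤ)) :=
  ⟨rfl, fun n ↦ Or.inr (Or.inl (by simp))⟩

lemma altSiteLaw_one_percolates : altSiteLaw 1 altSitePercolates = 1 := by
  rw [altSiteLaw, setBernoulli_one]
  exact Measure.dirac_apply_of_mem ⟨_, isInfinitePathFrom_vertical, fun _ ↦ Set.mem_univ _⟩

lemma altBondLaw_one_percolates : altBondLaw 1 altBondPercolates = 1 := by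
  rw [altBondLaw, setBernoulli_one]
  exact Measure.dirac_apply_of_mem
    ⟨_, isInfinitePathFrom_vertical, fun n ↦ isInfinitePathFrom_vertical.2 n⟩

end Models

theorem mainTheorem3 :
    (0.525 : ℝ) ≤ altSiteCriticalPoint ∧ (0.4022 : ℝ) ≤ altBondCriticalPoint := by
  constructor
  -- Nonemptiness, witnessed by `p = 1`, is essential: the real infimum of the empty set is `0`.
  · refine le_csInf ⟨1, 1, by simp, one_pos, ?_⟩ ?_
    · rw [altSiteLaw_one_percolates]
      exact one_pos
    · rintro r ⟨p, rfl, -, hpos⟩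
      by_contra hlt
      rw [altSiteLaw_percolates_eq_zero (not_le.1 hlt).le] at hpos
      exact lt_irrefl _ hpos
  · refine le_csInf ⟨1, 1, by simp, one_pos, ?_⟩ ?_
    · rw [altBondLaw_one_percolates]
      exact one_pos
    · rintro r ⟨p, rfl, -, hpos⟩
      by_contra hlt
      rw [altBondLaw_percolates_eq_zero (not_le.1 hlt).le] at hpos
      exact lt_irrefl _ hpos
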